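/- **Setting.** Graphs are finite directed graphs $G=(D,E)$ (loops allowed). A *dynamic program* for a Boolean graph query consists of: an auxiliary schema $\tau_{\mathrm{aux}}$ of relation symbols (no constant or function symbols); for every $R\in\tau_{\mathrm{aux}}$ of arity $n$ and every $\delta\in\{\mathrm{ins},\mathrm{del}\}$ a first-order update formula $\varphi^R_\delta(u,v;x_1,\dots,x_n)$ with equality over the schema $\{E\}\cup\tau_{\mathrm{aux}}$; an arbitrary initialization mapping, assigning to each finite graph an auxiliary database over the same domain; and a designated query symbol $q\in\tau_{\mathrm{aux}}$ of arity $0$. The initial state for $G$ consists of $G$ and the initial auxiliary database of $G$. When the modification $\delta(a,b)$ is applied in a state $\mathcal S$ over $D$, the edge relation is modified accordingly and, simultaneously, each $R$ is replaced by $\{\vec c \mid \mathcal S\models\varphi^R_\delta(a,b;\vec c)\}$. The program *maintains* a query $\mathcal Q$ *under insertions* if for every finite domain $D$, every graph $G$ on $D$ and every finite sequence $\alpha$ of edge insertions, the value of $q$ in the state reached from the initial state for $G$ via $\alpha$ equals $\mathcal Q(\alpha(G))$. The program is a *DynProp program* if all its update formulas are quantifier-free, and it is *$k$-ary* if all its auxiliary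 relation symbols have arity at most $k$. A graph $(D,E)$ is in $m$-Clique if there are $m$ distinct nodes $v_1,\dots,v_m\in D$ such that $(v_i,v_j)\in E$ or $(v_j,v_i)\in E$ for all $i\ne j$. **Theorem.** For every $k\ge 1$, the query $(k+2)$-Clique cannot be maintained under insertions by a $k$-ary DynProp program. On the other hand, $(k+2)$-Clique can be maintained under insertions by a $(k+1)$-ary DynProp program with finitely many auxiliary relation symbols; hence DynProp has a strict arity hierarchy for graph queries under insertions. -/

import Mathlib

/-- The two kinds of modification of the edge relation of a graph. -/
inductive ModKind where
  | ins
  | del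

/-- A modification of a directed graph on `D`: the insertion or the deletion of one pair of nodes
(no condition on the pair: it may be a loop, an inserted pair may already be an edge, a deleted
pair need not be one). -/
structure Modification (D : Type) where
  kind : ModKind
  src : D
  tgt : D

namespace Modification

variable {D : Type}

/-- The graph `α(G)`. -/
def apply (α : Modification D) (G : Digraph D) : Digraph D where
  Adj x y :=
    match α.kind with
    | .ins => G.Adj x y ∨ (x = α.src ∧ y = α.tgt)
    | .del => G.Adj x y ∧ ¬ (x = α.src ∧ y = α.tgt)

/-- The graph obtained from `G` by applying a sequence of modifications, first one first. -/
def applySeq (αs : List (Modification D)) (G : Digraph D) : Digraph D :=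
  αs.foldl (fun H α => α.apply H) G

end Modification

/-- A directed graph as a structure over the schema with one binary relation symbol. -/
@[reducible] def Digraph.toStructure {D : Type} (G : Digraph D) :
    FirstOrder.Language.graph.Structure D where
  RelMap | .adj => fun x => G.Adj (x 0) (x 1)

/-- The schema `τ = τ_in ∪ τ_aux`, for the input schema of graphs. -/
abbrev fullSchema (aux : FirstOrder.Language.{0, 0}) : FirstOrder.Language.{0, 0} :=
  FirstOrder.Language.graph.sum aux

/-- A program state `(D, G, A)`: the current graph and the auxiliary database. -/
structure ProgState (aux : FirstOrder.Language.{0, 0}) (D : Type) where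
  graph : Digraph D
  auxDB : aux.Structure D

/-- A program state is a structure over the full schema. -/
@[reducible] def ProgState.toStructure {aux : FirstOrder.Language.{0, 0}} {D : Type}
    (S : ProgState aux D) : (fullSchema aux).Structure D :=
  letI := S.graph.toStructure
  letI := S.auxDB
  FirstOrder.Language.sumStructure FirstOrder.Language.graph aux D

/-- A dynamic program with first-order update formulas for a Boolean query on directed graphs. -/
structure DynProgram where
  /-- The auxiliary schema. -/
  aux : FirstOrder.Language.{0, 0}
  /-- The auxiliary schema consists of relation symbols only: it contains neither constant
  symbols nor function symbols. -/
  relational : aux.IsRelational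
  /-- The update formula for a relation symbol `R` under a kind of modification. The variables
  `Sum.inl 0`, `Sum.inl 1` stand for the modified pair, the variables `Sum.inr i` for the
  auxiliary tuple whose membership in `R` is updated. -/
  update : ModKind → ∀ {n : ℕ}, aux.Relations n → (fullSchema aux).Formula (Fin 2 ⊕ Fin n)
  /-- The initialization mapping: an arbitrary map from finite graphs to auxiliary databases. -/
  initAux : ∀ (D : Type) [Finite D], Digraph D → aux.Structure D
  /-- The query symbol; it has arity `0` as the query is Boolean. -/
  query : aux.Relations 0

namespace DynProgram

variable (P : DynProgram) {D : Type}

/-- One step: every auxiliary relation is redefined, simultaneously, by its update formula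
evaluated in the old state, and the graph is modified. -/
def step (S : ProgState P.aux D) (α : Modification D) : ProgState P.aux D where
  graph := α.apply S.graph
  auxDB :=
    { funMap := fun f => ((P.relational _).false f).elim
      RelMap := fun R b =>
        letI := S.toStructure
        (P.update α.kind R).Realize (Sum.elim ![α.src, α.tgt] b) }

/-- The state reached from `S` by a sequence of modifications. -/
def steps (S : ProgState P.aux D) (αs : List (Modification D)) : ProgState P.aux D :=
  αs.foldl P.step S

/-- The initial state for a graph. -/
def initState [Finite D] (G : Digraph D) : ProgState P.aux D :=
  ⟨G, P.initAux D G⟩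

/-- The value of the query relation in a state. -/
def queryBit (S : ProgState P.aux D) : Prop :=
  S.auxDB.RelMap P.query Fin.elim0

/-- All update formulas are quantifier-free. -/
def IsQuantifierFree : Prop :=
  ∀ (δ : ModKind) (n : ℕ) (R : P.aux.Relations n), (P.update δ R).IsQF

/-- The program is `k`-ary: every auxiliary relation symbol has arity at most `k`. -/
def IsKAry (k : ℕ) : Prop :=
  ∀ n : ℕ, Nonempty (P.aux.Relations n) → n ≤ k

/-- There are only finitely many auxiliary relation symbols. -/
def HasFiniteSchema : Prop :=
  Finite (Σ n : ℕ, P.aux.Relations n)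

/-- The program maintains the Boolean graph query `Q` under insertions: for every finite domain,
every initial graph and every sequence of insertions, the query relation in the state reached is
the value of `Q` on the modified graph. -/
def MaintainsUnderInsertions (Q : ∀ D : Type, Digraph D → Prop) : Prop :=
  ∀ (D : Type) [Finite D] (G : Digraph D) (αs : List (Modification D)),
    (∀ α ∈ αs, α.kind = ModKind.ins) →
      (P.queryBit (P.steps (P.initState G) αs) ↔ Q D (Modification.applySeq αs G))

end DynProgram

/-- The `m`-clique query: there are `m` distinct nodes such that any two different ones of them
are joined by an edge in at least one direction. -/
def cliqueQuery (m : ℕ) (D : Type) (G : Digraph D) : Prop :=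
  ∃ v : Fin m → D, Function.Injective v ∧
    ∀ i j : Fin m, i ≠ j → G.Adj (v i) (v j) ∨ G.Adj (v j) (v i)

/-! Lower bound: a quantifier-free update reads only the modified pair and the tuple being updated.
Hence after boundedly many modifications inside a set `A`, the query bit depends only on the initial
graph on `A` and finitely many auxiliary relations on `A` (`exists_finite_queryBit_iff`). A relation
`S` of arity `k + 1` over `Fin N` is encoded by tuple nodes joined to coordinate nodes, and `(k + 1)
^ 2` insertions among coordinates test `f ∈ S` (`cliqueQuery_applySeq_coordInsertions`). All `2 ^ N
^ (k + 1)` relations must thus be told apart by boundedly many relations of arity at most `k` on `(k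
+ 1) * N` nodes, which fails for large `N`.

Upper bound: store which tuples extend to cliques, ignoring edges inside the tuple. When an edge is
inserted, its endpoints among the new nodes move into the tuple, where the edge between them is not
required (`cliqueExtension_insertion_iff`). A tuple of length `k + 2` needs no further node, so
arity `k + 1` suffices. -/

/-! ### Locality of quantifier-free updates. -/

open FirstOrder FirstOrder.Language in
theorem FirstOrder.Language.Term.exists_eq_var {L : FirstOrder.Language.{0, 0}} [L.IsRelational] {α : Type}
    (t : L.Term α) : ∃ a, t = Term.var a := by
  cases t with
  | var a => exact ⟨a, rfl⟩
  | func f _ => exact isEmptyElim f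

/-- Two program states over the same domain agree on the set `A` with respect to the graph and
the auxiliary relations in `F`. -/
def ProgState.Agree {aux : FirstOrder.Language.{0, 0}} {D : Type}
    (F : Set (Σ n, aux.Relations n)) (A : Set D) (S T : ProgState aux D) : Prop :=
  (∀ x ∈ A, ∀ y ∈ A, (S.graph.Adj x y ↔ T.graph.Adj x y)) ∧
    ∀ R ∈ F, ∀ b : Fin R.1 → D, (∀ i, b i ∈ A) →
      (S.auxDB.RelMap R.2 b ↔ T.auxDB.RelMap R.2 b)

theorem ProgState.Agree.mono {aux : FirstOrder.Language.{0, 0}} {D : Type}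
    {F F' : Set (Σ n, aux.Relations n)} (h : F ⊆ F') {A : Set D} {S T : ProgState aux D}
    (hST : ProgState.Agree F' A S T) : ProgState.Agree F A S T :=
  ⟨hST.1, fun R hR => hST.2 R (h hR)⟩

open FirstOrder FirstOrder.Language in
/-- The truth value of a quantifier-free formula on tuples from `A` is determined by finitely many
relations restricted to `A`. -/
theorem exists_finite_symbols_of_isQF {aux : FirstOrder.Language.{0, 0}} [aux.IsRelational] {α : Type}
    {n : ℕ} {φ : (fullSchema aux).BoundedFormula α n} (hφ : φ.IsQF) :
    ∃ F : Set (Σ n, aux.Relations n), F.Finite ∧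
      ∀ (D : Type) (A : Set D) (S T : ProgState aux D), ProgState.Agree F A S T →
        ∀ (v : α → D) (xs : Fin n → D), (∀ a, v a ∈ A) → (∀ i, xs i ∈ A) →
          (@BoundedFormula.Realize _ D S.toStructure _ _ φ v xs ↔
            @BoundedFormula.Realize _ D T.toStructure _ _ φ v xs) := by
  have elim_mem {D : Type} {A : Set D} {v : α → D} {xs : Fin n → D} (hv : ∀ a, v a ∈ A)
      (hxs : ∀ i, xs i ∈ A) (c : α ⊕ Fin n) : Sum.elim v xs c ∈ A := by
    cases c
    · exact hv _
    · exact hxs _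
  induction hφ with
  | falsum => exact ⟨∅, Set.finite_empty, fun D A S T _ v xs _ _ => Iff.rfl⟩
  | of_isAtomic h =>
    cases h with
    | equal t₁ t₂ =>
      refine ⟨∅, Set.finite_empty, fun D A S T _ v xs _ _ => ?_⟩
      obtain ⟨a, rfl⟩ := t₁.exists_eq_var
      obtain ⟨b, rfl⟩ := t₂.exists_eq_var
      exact Iff.rfl
    | rel R ts =>
      choose c hc using fun i => (ts i).exists_eq_var
      obtain rfl : ts = fun i => Term.var (c i) := funext hc
      rcases R with R | R
      · refine ⟨∅, Set.finite_empty, fun D A S T hST v xs hv hxs => ?_⟩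
        cases R
        exact hST.1 _ (elim_mem hv hxs (c 0)) _ (elim_mem hv hxs (c 1))
      · refine ⟨{⟨_, R⟩}, Set.finite_singleton _, fun D A S T hST v xs hv hxs => ?_⟩
        exact hST.2 ⟨_, R⟩ rfl (fun i => Sum.elim v xs (c i)) fun i => elim_mem hv hxs (c i)
  | imp _ _ ih₁ ih₂ =>
    obtain ⟨F₁, hF₁, h₁⟩ := ih₁
    obtain ⟨F₂, hF₂, h₂⟩ := ih₂
    refine ⟨F₁ ∪ F₂, hF₁.union hF₂, fun D A S T hST v xs hv hxs => ?_⟩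
    exact imp_congr (h₁ D A S T (hST.mono Set.subset_union_left) v xs hv hxs)
      (h₂ D A S T (hST.mono Set.subset_union_right) v xs hv hxs)

namespace DynProgram

/-- The schema may be infinite, but the update formulas of finitely many symbols mention only
finitely many symbols. -/
theorem exists_finite_agree_step (P : DynProgram) (hP : P.IsQuantifierFree)
    {F : Set (Σ n, P.aux.Relations n)} (hF : F.Finite) :
    ∃ F' : Set (Σ n, P.aux.Relations n), F'.Finite ∧
      ∀ (D : Type) (A : Set D) (S T : ProgState P.aux D) (α : Modification D),
        α.src ∈ A → α.tgt ∈ A → ProgState.Agree F' A S T →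
          ProgState.Agree F A (P.step S α) (P.step T α) := by
  have := P.relational
  choose f hf h using fun (δ : ModKind) (R : Σ n, P.aux.Relations n) =>
    exists_finite_symbols_of_isQF (hP δ R.1 R.2)
  refine ⟨⋃ R ∈ F, f .ins R ∪ f .del R,
    hF.biUnion fun R _ => (hf _ _).union (hf _ _), fun D A S T α hs ht hST => ⟨?_, ?_⟩⟩
  · intro x hx y hy
    obtain ⟨_ | _, s, t⟩ := α
    · exact or_congr (hST.1 x hx y hy) Iff.rfl
    · exact and_congr (hST.1 x hx y hy) Iff.rfl
  · intro R hR b hb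
    refine h α.kind R D A S T (hST.mono ?_) (Sum.elim ![α.src, α.tgt] b) _ ?_ fun i => i.elim0
    · refine Set.Subset.trans ?_ (Set.subset_biUnion_of_mem hR)
      cases α.kind
      · exact Set.subset_union_left
      · exact Set.subset_union_right
    · rintro (i | i)
      · fin_cases i
        · exact hs
        · exact ht
      · exact hb i

/-- The needed symbols are pulled back one modification at a time; the result depends on the number
of modifications only, not on the domain or the sequence. -/
theorem exists_finite_agree_steps (P : DynProgram) (hP : P.IsQuantifierFree)
    {F : Set (Σ n, P.aux.Relations n)} (hF : F.Finite) (m : ℕ) :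
    ∃ F' : Set (Σ n, P.aux.Relations n), F'.Finite ∧
      ∀ (D : Type) (A : Set D) (S T : ProgState P.aux D) (αs : List (Modification D)),
        αs.length = m → (∀ α ∈ αs, α.src ∈ A ∧ α.tgt ∈ A) → ProgState.Agree F' A S T →
          ProgState.Agree F A (P.steps S αs) (P.steps T αs) := by
  induction m with
  | zero =>
    refine ⟨F, hF, fun D A S T αs hl _ hST => ?_⟩
    obtain rfl := List.length_eq_zero_iff.1 hl
    exact hST
  | succ m ih =>
    obtain ⟨F₁, hF₁, h₁⟩ := ih
    obtain ⟨F₂, hF₂, h₂⟩ := P.exists_finite_agree_step hP hF₁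
    refine ⟨F₂, hF₂, fun D A S T αs hl hα hST => ?_⟩
    obtain _ | ⟨α, αs⟩ := αs
    · simp at hl
    · have hmem := hα α List.mem_cons_self
      exact h₁ D A _ _ αs (by simpa using hl) (fun β hβ => hα β (List.mem_cons_of_mem _ hβ))
        (h₂ D A S T α hmem.1 hmem.2 hST)

/-- After a fixed number of modifications inside `A`, the query bit of a quantifier-free program is
determined by finitely many relations of the initial state, restricted to `A`. -/
theorem exists_finite_queryBit_iff (P : DynProgram) (hP : P.IsQuantifierFree) (m : ℕ) :
    ∃ F : Set (Σ n, P.aux.Relations n), F.Finite ∧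
      ∀ (D : Type) (A : Set D) (S T : ProgState P.aux D) (αs : List (Modification D)),
        αs.length = m → (∀ α ∈ αs, α.src ∈ A ∧ α.tgt ∈ A) → ProgState.Agree F A S T →
          (P.queryBit (P.steps S αs) ↔ P.queryBit (P.steps T αs)) := by
  obtain ⟨F, hF, h⟩ := P.exists_finite_agree_steps hP (Set.finite_singleton ⟨0, P.query⟩) m
  exact ⟨F, hF, fun D A S T αs hl hα hST =>
    (h D A S T αs hl hα hST).2 ⟨0, P.query⟩ rfl Fin.elim0 fun i => i.elim0⟩

end DynProgram

/-! ### Encoding relations in graphs, and the counting argument. -/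

theorem Modification.applySeq_adj_of_ins {D : Type} (αs : List (Modification D))
    (hα : ∀ α ∈ αs, α.kind = ModKind.ins) (G : Digraph D) (x y : D) :
    (Modification.applySeq αs G).Adj x y ↔
      G.Adj x y ∨ ∃ α ∈ αs, x = α.src ∧ y = α.tgt := by
  induction αs generalizing G with
  | nil => simp [Modification.applySeq]
  | cons α αs ih =>
    have hk := hα α List.mem_cons_self
    have hstep : (α.apply G).Adj x y ↔ G.Adj x y ∨ (x = α.src ∧ y = α.tgt) := by
      obtain ⟨_, s, t⟩ := α
      obtain rfl := hk
      exact Iff.rfl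
    have := ih (fun β hβ => hα β (List.mem_cons_of_mem _ hβ)) (α.apply G)
    rw [List.exists_mem_cons_iff, ← or_assoc, ← hstep]
    exact this

/-- The nodes of the graphs that encode `r`-ary relations over `Fin N`: a copy of `Fin N` for
every coordinate, and one node for every `r`-tuple. -/
abbrev EncNode (r N : ℕ) : Type := (Fin r × Fin N) ⊕ (Fin r → Fin N)

/-- The node of a tuple in `S` is joined to its coordinates, and there are no other edges. -/
def encGraph {r N : ℕ} (S : Set (Fin r → Fin N)) : Digraph (EncNode r N) where
  Adj x y := ∃ f ∈ S, ∃ i, x = Sum.inl (i, f i) ∧ y = Sum.inr f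

/-- The insertion of all edges between the coordinates of a tuple. -/
noncomputable def coordInsertions {r N : ℕ} (f : Fin r → Fin N) :
    List (Modification (EncNode r N)) :=
  (Finset.univ : Finset (Fin r × Fin r)).toList.map fun p =>
    ⟨ModKind.ins, Sum.inl (p.1, f p.1), Sum.inl (p.2, f p.2)⟩

theorem coordInsertions_kind {r N : ℕ} (f : Fin r → Fin N) :
    ∀ α ∈ coordInsertions f, α.kind = ModKind.ins := by
  rintro α hα
  obtain ⟨p, -, rfl⟩ := List.mem_map.1 hα
  rfl

theorem coordInsertions_mem_range {r N : ℕ} (f : Fin r → Fin N) :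
    ∀ α ∈ coordInsertions f, α.src ∈ Set.range Sum.inl ∧ α.tgt ∈ Set.range Sum.inl := by
  rintro α hα
  obtain ⟨p, -, rfl⟩ := List.mem_map.1 hα
  exact ⟨⟨_, rfl⟩, ⟨_, rfl⟩⟩

theorem applySeq_coordInsertions_adj {r N : ℕ} (S : Set (Fin r → Fin N)) (f : Fin r → Fin N)
    (x y : EncNode r N) :
    (Modification.applySeq (coordInsertions f) (encGraph S)).Adj x y ↔
      (∃ g ∈ S, ∃ i, x = Sum.inl (i, g i) ∧ y = Sum.inr g) ∨
        ∃ i j, x = Sum.inl (i, f i) ∧ y = Sum.inl (j, f j) := by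
  rw [Modification.applySeq_adj_of_ins _ (coordInsertions_kind f)]
  simp [encGraph, coordInsertions]

/-- Tuple nodes are pairwise non-adjacent, and only the `k + 1` coordinates of `f` are joined among
themselves. So a clique consists of one tuple node `g` and all coordinates of `g`; as `1 ≤ k`, each
of these is adjacent to another one, which forces `g = f`. -/
theorem cliqueQuery_applySeq_coordInsertions {k N : ℕ} (hk : 1 ≤ k)
    (S : Set (Fin (k + 1) → Fin N)) (f : Fin (k + 1) → Fin N) :
    cliqueQuery (k + 2) _ (Modification.applySeq (coordInsertions f) (encGraph S)) ↔ f ∈ S := by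
  constructor
  · rintro ⟨v, hinj, hv⟩
    simp only [applySeq_coordInsertions_adj] at hv
    have : Nontrivial (Fin (k + 1)) := Fin.nontrivial_iff_two_le.2 (by omega)
    -- two different `inl` nodes of the clique are coordinates of `f`
    have hinl (i j : Fin (k + 2)) (hij : i ≠ j) (a b) (hi : v i = Sum.inl a)
        (hj : v j = Sum.inl b) : a.2 = f a.1 := by
      have := hv i j hij
      rw [hi, hj] at this
      simp only [reduceCtorEq, and_false, exists_false, false_or, Sum.inl.injEq] at this
      rcases this with ⟨i, j, rfl, rfl⟩ | ⟨i, j, rfl, rfl⟩ <;> rfl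
    by_cases hex : ∃ i g, v i = Sum.inr g
    · obtain ⟨i, g, hi⟩ := hex
      have hother (j : Fin (k + 1)) : g ∈ S ∧ ∃ l, v (i.succAbove j) = Sum.inl (l, g l) := by
        have := hv i (i.succAbove j) (Fin.succAbove_ne i j).symm
        rw [hi] at this
        simp only [reduceCtorEq, false_and, and_false, exists_false, false_or, or_false,
          Sum.inr.injEq] at this
        obtain ⟨g', hg', l, hl, rfl⟩ := this
        exact ⟨hg', l, hl⟩
      choose hg l hl using hother
      have hlinj : Function.Injective l := fun a b hab => by
        apply Fin.succAbove_right_injective (p := i)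
        apply hinj
        rw [hl, hl, hab]
      have hgf : g = f := by
        funext c
        obtain ⟨a, rfl⟩ := (Finite.injective_iff_surjective.1 hlinj) c
        obtain ⟨b, hb⟩ := exists_ne a
        exact hinl _ _ (fun h => hb (Fin.succAbove_right_injective h).symm) _ _ (hl a) (hl b)
      exact hgf ▸ hg 0
    · exfalso
      have hl (i : Fin (k + 2)) : ∃ a, v i = Sum.inl a := by
        rcases h : v i with a | g
        · exact ⟨a, rfl⟩
        · exact (hex ⟨i, g, h⟩).elim
      choose a ha using hl
      have hainj : Function.Injective fun i => (a i).1 := fun i j hij => by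
        by_contra hne
        have h₁ := hinl i j hne _ _ (ha i) (ha j)
        have h₂ := hinl j i (Ne.symm hne) _ _ (ha j) (ha i)
        refine hne (hinj ?_)
        rw [ha, ha]
        exact congrArg _ (Prod.ext hij (by rw [h₁, h₂]; exact congrArg f hij))
      simpa using Fintype.card_le_of_injective _ hainj
  · intro hf
    refine ⟨Fin.cons (Sum.inr f) fun i => Sum.inl (i, f i), ?_, ?_⟩
    · rw [Fin.cons_injective_iff]
      refine ⟨by simp, fun i j hij => ?_⟩
      simp only [Sum.inl.injEq, Prod.mk.injEq] at hij
      exact hij.1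
    · intro i j hij
      simp only [applySeq_coordInsertions_adj]
      cases i using Fin.cases with
      | zero =>
        cases j using Fin.cases with
        | zero => exact (hij rfl).elim
        | succ j => exact Or.inr (Or.inl ⟨f, hf, j, by simp⟩)
      | succ i =>
        cases j using Fin.cases with
        | zero => exact Or.inl (Or.inl ⟨f, hf, i, by simp⟩)
        | succ j => exact Or.inl (Or.inr ⟨i, j, by simp⟩)

theorem not_maintains_cliqueQuery_of_isKAry {k : ℕ} (hk : 1 ≤ k) (P : DynProgram)
    (hQF : P.IsQuantifierFree) (hA : P.IsKAry k) :
    ¬ P.MaintainsUnderInsertions (cliqueQuery (k + 2)) := by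
  classical
  intro hM
  -- The number of insertions does not involve `N`, so `F` is available before `N` is chosen.
  obtain ⟨F, hF, h⟩ := P.exists_finite_queryBit_iff hQF
    (Finset.univ : Finset (Fin (k + 1) × Fin (k + 1))).toList.length
  have := hF.fintype
  set N := Fintype.card F * (k + 1) ^ k + 1 with hN
  -- Only coordinate nodes are recorded: their number is linear in `N`, whereas there are `N ^ (k +
  -- 1)` tuple nodes.
  let Φ : Set (Fin (k + 1) → Fin N) → ∀ R : F, (Fin R.1.1 → Fin (k + 1) × Fin N) → Prop :=
    fun S R b => (P.initAux _ (encGraph S)).RelMap R.1.2 fun i => Sum.inl (b i)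
  have hΦ : Function.Injective Φ := by
    intro S T hST
    have hagree : ProgState.Agree F (Set.range Sum.inl) (P.initState (encGraph S))
        (P.initState (encGraph T)) := by
      refine ⟨?_, fun R hR b hb => ?_⟩
      · rintro _ ⟨x, rfl⟩ _ ⟨y, rfl⟩
        simp [DynProgram.initState, encGraph]
      · choose c hc using hb
        obtain rfl : (fun i => Sum.inl (c i)) = b := funext hc
        exact iff_of_eq (congrFun (congrFun hST ⟨R, hR⟩) c)
    ext f
    rw [← cliqueQuery_applySeq_coordInsertions hk S f,
      ← cliqueQuery_applySeq_coordInsertions hk T f,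
      ← hM _ _ _ (coordInsertions_kind f), ← hM _ _ _ (coordInsertions_kind f)]
    exact h _ (Set.range Sum.inl) _ _ _ (List.length_map _) (coordInsertions_mem_range f) hagree
  have hcard := Fintype.card_le_of_injective Φ hΦ
  simp only [Fintype.card_pi, Fintype.card_set, Fintype.card_prop, Finset.prod_const,
    Finset.card_univ, Fintype.card_fin, Fintype.card_prod] at hcard
  have hbound : ∏ R : F, 2 ^ ((k + 1) * N) ^ R.1.1 ≤
      2 ^ (((k + 1) * N) ^ k * Fintype.card F) := by
    rw [pow_mul, ← Finset.card_univ, ← Finset.prod_const]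
    refine Finset.prod_le_prod' fun R _ => ?_
    exact Nat.pow_le_pow_right two_pos
      (Nat.pow_le_pow_right (by positivity) (hA _ ⟨R.1.2⟩))
  have hle := (Nat.pow_le_pow_iff_right one_lt_two).1 (hcard.trans hbound)
  -- Comparing exponents and cancelling `N ^ k` bounds `N` by one less than its chosen value.
  have : N * N ^ k ≤ (Fintype.card F * (k + 1) ^ k) * N ^ k := by
    calc N * N ^ k = N ^ (k + 1) := by ring
      _ ≤ _ := hle
      _ = _ := by rw [mul_pow]; ring
  have := Nat.le_of_mul_le_mul_right this (by positivity)
  omega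

/-! ### Clique extensions and their recurrence under insertions. -/

/-- The set `X` can be extended by `m - j` further nodes such that each of the new nodes is joined
to all other nodes; edges inside `X` are not required. -/
def CliqueExtension (m : ℕ) {D : Type} (G : Digraph D) (j : ℕ) (X : Set D) : Prop :=
  ∃ Y : Finset D, Y.card + j = m ∧ (∀ y ∈ Y, y ∉ X) ∧
    ∀ y ∈ Y, ∀ z, z ∈ Y ∨ z ∈ X → z ≠ y → G.Adj z y ∨ G.Adj y z

/-- After the insertion of an edge between `a` and `b`, the node `a` lies outside `X` and is joined
to every node of `X`. -/
def Attachable {D : Type} (G : Digraph D) (a b : D) (X : Set D) : Prop :=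
  ∀ z ∈ X, z ≠ a ∧ ((G.Adj z a ∨ G.Adj a z) ∨ z = b)

theorem cliqueExtension_self (m : ℕ) {D : Type} (G : Digraph D) (X : Set D) :
    CliqueExtension m G m X :=
  ⟨∅, by simp⟩

theorem not_cliqueExtension_of_lt {m : ℕ} {D : Type} (G : Digraph D) {j : ℕ} (h : m < j)
    (X : Set D) : ¬ CliqueExtension m G j X := by
  rintro ⟨Y, hY, -⟩
  omega

theorem cliqueQuery_iff_cliqueExtension (m : ℕ) {D : Type} (G : Digraph D) :
    cliqueQuery m D G ↔ CliqueExtension m G 0 ∅ := by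
  classical
  constructor
  · rintro ⟨v, hv, h⟩
    refine ⟨Finset.univ.image v, ?_, by simp, ?_⟩
    · rw [Finset.card_image_of_injective _ hv, Finset.card_univ, Fintype.card_fin, add_zero]
    · simp only [Finset.mem_image, Finset.mem_univ, true_and, Set.mem_empty_iff_false, or_false]
      rintro _ ⟨i, rfl⟩ _ ⟨j, rfl⟩ hij
      exact h j i fun e => hij (congrArg v e)
  · rintro ⟨Y, hY, -, h⟩
    have e : Fin m ≃ Y := (Y.equivFinOfCardEq (by simpa using hY)).symm
    refine ⟨fun i => e i, Subtype.val_injective.comp e.injective, fun i j hij => ?_⟩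
    exact h _ (e j).2 _ (Or.inl (e i).2) fun he => hij (e.injective (Subtype.ext he))

theorem CliqueExtension.mono {m : ℕ} {D : Type} {G H : Digraph D}
    (hGH : ∀ x y, G.Adj x y → H.Adj x y) {j : ℕ} {X : Set D} (h : CliqueExtension m G j X) :
    CliqueExtension m H j X := by
  obtain ⟨Y, hY, hd, h⟩ := h
  exact ⟨Y, hY, hd, fun y hy z hz hne => (h y hy z hz hne).imp (hGH _ _) (hGH _ _)⟩

/-- The node `a` moves from the prescribed set to the new nodes. Its edges to `Y` are already
present; those to `X` are the extra price. -/
theorem CliqueExtension.of_insert {m : ℕ} {D : Type} {G : Digraph D} {j : ℕ} {X : Set D} {a : D}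
    (ha : ∀ z ∈ X, z ≠ a ∧ (G.Adj z a ∨ G.Adj a z)) (h : CliqueExtension m G (j + 1) (insert a X)) :
    CliqueExtension m G j X := by
  classical
  obtain ⟨Y, hY, hd, h⟩ := h
  have haY : a ∉ Y := fun hmem => hd a hmem (Set.mem_insert _ _)
  refine ⟨insert a Y, by rw [Finset.card_insert_of_notMem haY]; omega, ?_, ?_⟩
  · intro y hy hyX
    rcases Finset.mem_insert.1 hy with rfl | hy
    · exact (ha y hyX).1 rfl
    · exact hd y hy (Set.mem_insert_of_mem _ hyX)
  · intro y hy z hz hne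
    rcases Finset.mem_insert.1 hy with rfl | hy
    · rcases hz with hz | hz
      · have hz := Finset.mem_of_mem_insert_of_ne hz hne
        exact (h z hz y (Or.inr (Set.mem_insert _ _)) hne.symm).symm
      · exact (ha z hz).2
    · refine h y hy z ?_ hne
      rcases hz with hz | hz
      · rcases Finset.mem_insert.1 hz with rfl | hz
        · exact Or.inr (Set.mem_insert _ _)
        · exact Or.inl hz
      · exact Or.inr (Set.mem_insert_of_mem _ hz)

/-- How the existence of clique extensions changes under the insertion of an edge. -/
theorem cliqueExtension_insertion_iff {m : ℕ} {D : Type} (G : Digraph D) (u v : D) (j : ℕ)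
    (X : Set D) :
    CliqueExtension m (Modification.apply ⟨.ins, u, v⟩ G) j X ↔
      CliqueExtension m G j X ∨
        (Attachable G v u X ∧ CliqueExtension m G (j + 1) (insert v X)) ∨
        (Attachable G u v X ∧ CliqueExtension m G (j + 1) (insert u X)) ∨
        (u ≠ v ∧ Attachable G v u X ∧ Attachable G u v X ∧
          CliqueExtension m G (j + 2) (insert u (insert v X))) := by
  classical
  set H := Modification.apply ⟨.ins, u, v⟩ G with hH
  have hadj (x y : D) : H.Adj x y ↔ G.Adj x y ∨ (x = u ∧ y = v) := Iff.rfl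
  have hmono (x y : D) (h : G.Adj x y) : H.Adj x y := Or.inl h
  have hv {X : Set D} (h : Attachable G v u X) : ∀ z ∈ X, z ≠ v ∧ (H.Adj z v ∨ H.Adj v z) := by
    intro z hz
    refine ⟨(h z hz).1, ?_⟩
    rcases (h z hz).2 with (h | h) | rfl
    · exact Or.inl (hmono _ _ h)
    · exact Or.inr (hmono _ _ h)
    · exact Or.inl (Or.inr ⟨rfl, rfl⟩)
  have hu {X : Set D} (h : Attachable G u v X) : ∀ z ∈ X, z ≠ u ∧ (H.Adj z u ∨ H.Adj u z) := by
    intro z hz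
    refine ⟨(h z hz).1, ?_⟩
    rcases (h z hz).2 with (h | h) | rfl
    · exact Or.inl (hmono _ _ h)
    · exact Or.inr (hmono _ _ h)
    · exact Or.inr (Or.inr ⟨rfl, rfl⟩)
  constructor
  · rintro ⟨Y, hY, hd, h⟩
    have hold (y : D) (hy : y ∈ Y) (z : D) (hz : z ∈ Y ∨ z ∈ X) (hne : z ≠ y)
        (hnew : ¬ (z = u ∧ y = v)) (hnew' : ¬ (y = u ∧ z = v)) : G.Adj z y ∨ G.Adj y z := by
      have := h y hy z hz hne
      rw [hadj, hadj] at this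
      tauto
    have hattv (hvY : v ∈ Y) : Attachable G v u X := fun z hz => by
      have hzv : z ≠ v := fun e => hd v hvY (e ▸ hz)
      refine ⟨hzv, or_iff_not_imp_right.2 fun hzu => ?_⟩
      exact hold v hvY z (Or.inr hz) hzv (fun e => hzu e.1) fun e => hzv e.2
    have hattu (huY : u ∈ Y) : Attachable G u v X := fun z hz => by
      have hzu : z ≠ u := fun e => hd u huY (e ▸ hz)
      refine ⟨hzu, or_iff_not_imp_right.2 fun hzv => ?_⟩
      exact hold u huY z (Or.inr hz) hzu (fun e => hzu e.1) fun e => hzv e.2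
    -- The endpoints lying in `Y` are moved to the prescribed set; all edges still required are then
    -- old.
    by_cases hvY : v ∈ Y
    · by_cases huY : u ∈ Y
      · by_cases huv : u = v
        · subst huv
          exact Or.inl ⟨Y, hY, hd, fun y hy z hz hne => hold y hy z hz hne
            (fun e => hne (e.1.trans e.2.symm)) fun e => hne (e.2.trans e.1.symm)⟩
        · refine Or.inr (Or.inr (Or.inr ⟨huv, hattv hvY, hattu huY, (Y.erase v).erase u, ?_, ?_, ?_⟩))
          · have huY' : u ∈ Y.erase v := Finset.mem_erase.2 ⟨huv, huY⟩
            have h₁ := Finset.card_erase_add_one huY'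
            have h₂ := Finset.card_erase_add_one hvY
            omega
          · simp only [Finset.mem_erase, Set.mem_insert_iff]
            rintro y ⟨hyu, hyv, hy⟩ (e | e | e)
            exacts [hyu e, hyv e, hd y hy e]
          · simp only [Finset.mem_erase, Set.mem_insert_iff]
            rintro y ⟨hyu, hyv, hy⟩ z hz hne
            refine hold y hy z ?_ hne (fun e => hyv e.2) fun e => hyu e.1
            rcases hz with hz | rfl | rfl | hz
            exacts [Or.inl hz.2.2, Or.inl huY, Or.inl hvY, Or.inr hz]
      · refine Or.inr (Or.inl ⟨hattv hvY, Y.erase v, ?_, ?_, ?_⟩)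
        · have := Finset.card_erase_add_one hvY
          omega
        · simp only [Finset.mem_erase, Set.mem_insert_iff]
          rintro y ⟨hyv, hy⟩ (e | e)
          exacts [hyv e, hd y hy e]
        · simp only [Finset.mem_erase, Set.mem_insert_iff]
          rintro y ⟨hyv, hy⟩ z hz hne
          refine hold y hy z ?_ hne (fun e => hyv e.2) fun e => huY (e.1 ▸ hy)
          rcases hz with hz | rfl | hz
          exacts [Or.inl hz.2, Or.inl hvY, Or.inr hz]
    · by_cases huY : u ∈ Y
      · refine Or.inr (Or.inr (Or.inl ⟨hattu huY, Y.erase u, ?_, ?_, ?_⟩))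
        · have := Finset.card_erase_add_one huY
          omega
        · simp only [Finset.mem_erase, Set.mem_insert_iff]
          rintro y ⟨hyu, hy⟩ (e | e)
          exacts [hyu e, hd y hy e]
        · simp only [Finset.mem_erase, Set.mem_insert_iff]
          rintro y ⟨hyu, hy⟩ z hz hne
          refine hold y hy z ?_ hne (fun e => hvY (e.2 ▸ hy)) fun e => hyu e.1
          rcases hz with hz | rfl | hz
          exacts [Or.inl hz.2, Or.inl huY, Or.inr hz]
      · exact Or.inl ⟨Y, hY, hd, fun y hy z hz hne => hold y hy z hz hne
          (fun e => hvY (e.2 ▸ hy)) fun e => huY (e.1 ▸ hy)⟩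
  · rintro (h | ⟨ha, h⟩ | ⟨ha, h⟩ | ⟨huv, hav, hau, h⟩)
    · exact h.mono hmono
    · exact (h.mono hmono).of_insert (hv ha)
    · exact (h.mono hmono).of_insert (hu ha)
    · refine ((h.mono hmono).of_insert (j := j + 1) fun z hz => ?_).of_insert (hv hav)
      rcases hz with rfl | hz
      · exact ⟨huv.symm, Or.inr (Or.inr ⟨rfl, rfl⟩)⟩
      · exact hu hau z hz

/-! ### The program as quantifier-free formulas. -/

section

open FirstOrder FirstOrder.Language

theorem FirstOrder.Language.BoundedFormula.IsQF.iInf {L : FirstOrder.Language.{0, 0}} {α β : Type} {n : ℕ}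
    [Finite β] {f : β → L.BoundedFormula α n} (hf : ∀ b, (f b).IsQF) :
    (BoundedFormula.iInf f).IsQF := by
  have hfold (l : List (L.BoundedFormula α n)) (hl : ∀ φ ∈ l, φ.IsQF) :
      (l.foldr (· ⊓ ·) ⊤).IsQF := by
    induction l with
    | nil => exact BoundedFormula.IsQF.top
    | cons φ l ih =>
      exact (hl φ List.mem_cons_self).inf (ih fun ψ hψ => hl ψ (List.mem_cons_of_mem _ hψ))
  refine hfold _ fun φ hφ => ?_
  obtain ⟨b, -, rfl⟩ := List.mem_map.1 hφ
  exact hf b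

/-- The auxiliary schema with one relation symbol of each arity up to `k + 1`. -/
def cliqueSchema (k : ℕ) : FirstOrder.Language.{0, 0} :=
  ⟨fun _ => Empty, fun n => PLift (n ≤ k + 1)⟩

instance (k : ℕ) : (cliqueSchema k).IsRelational := fun _ => inferInstanceAs (IsEmpty Empty)

/-- The auxiliary relations: the tuples whose sets of entries have clique extensions. -/
@[reducible] def cliqueDB (k : ℕ) {D : Type} (G : Digraph D) : (cliqueSchema k).Structure D where
  funMap f := f.elim
  -- The count is the length `n` even if `x` has repeated entries; the recurrence never relates it
  -- to the size of the set.
  RelMap {n} _ x := CliqueExtension (k + 2) G n (Set.range x)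

/-- The state in which the auxiliary relations are correct for the graph. -/
def cliqueState (k : ℕ) {D : Type} (G : Digraph D) : ProgState (cliqueSchema k) D :=
  ⟨G, cliqueDB k G⟩

namespace CliqueProgram

variable {k : ℕ} {α : Type}

/-- The formula `x = y`. -/
def eqFormula (x y : α) : (fullSchema (cliqueSchema k)).Formula α :=
  Term.equal (Term.var x) (Term.var y)

/-- The formula `E(x, y)`. -/
def edgeFormula (x y : α) : (fullSchema (cliqueSchema k)).Formula α :=
  Relations.formula (L := fullSchema (cliqueSchema k)) (n := 2) (Sum.inl graphRel.adj)
    ![Term.var x, Term.var y]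

/-- The formula stating that the set of the nodes `t i` has a clique extension. -/
def extFormula {j : ℕ} (t : Fin j → α) : (fullSchema (cliqueSchema k)).Formula α :=
  if h : j ≤ k + 1 then
    Relations.formula (L := fullSchema (cliqueSchema k)) (n := j) (Sum.inr ⟨h⟩)
      fun i => Term.var (t i)
  else if j = k + 2 then ⊤ else ⊥

/-- The formula stating `Attachable` for the nodes `a` and `b` and the set of the nodes `t i`. -/
noncomputable def attachFormula {j : ℕ} (a b : α) (t : Fin j → α) :
    (fullSchema (cliqueSchema k)).Formula α :=
  BoundedFormula.iInf fun i : Fin j =>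
    (eqFormula (t i) a).not ⊓
      ((edgeFormula (t i) a ⊔ edgeFormula a (t i)) ⊔ eqFormula (t i) b)

/-- The update formula for insertions of the relation of arity `n`. -/
noncomputable def insFormula (k n : ℕ) : (fullSchema (cliqueSchema k)).Formula (Fin 2 ⊕ Fin n) :=
  let u := Sum.inl 0
  let v := Sum.inl 1
  extFormula Sum.inr ⊔
    ((attachFormula v u Sum.inr ⊓ extFormula (Fin.cons v Sum.inr : Fin (n + 1) → _)) ⊔
      ((attachFormula u v Sum.inr ⊓ extFormula (Fin.cons u Sum.inr : Fin (n + 1) → _)) ⊔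
        ((eqFormula u v).not ⊓ (attachFormula v u Sum.inr ⊓ (attachFormula u v Sum.inr ⊓
          extFormula (Fin.cons u (Fin.cons v Sum.inr : Fin (n + 1) → _) : Fin (n + 2) → _))))))

theorem eqFormula_isQF (x y : α) : (eqFormula (k := k) x y).IsQF :=
  (BoundedFormula.IsAtomic.equal _ _).isQF

theorem edgeFormula_isQF (x y : α) : (edgeFormula (k := k) x y).IsQF :=
  (BoundedFormula.IsAtomic.rel _ _).isQF

theorem extFormula_isQF {j : ℕ} (t : Fin j → α) : (extFormula (k := k) t).IsQF := by
  unfold extFormula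
  split_ifs
  · exact (BoundedFormula.IsAtomic.rel _ _).isQF
  · exact BoundedFormula.IsQF.top
  · exact BoundedFormula.isQF_bot

theorem attachFormula_isQF {j : ℕ} (a b : α) (t : Fin j → α) :
    (attachFormula (k := k) a b t).IsQF :=
  .iInf fun _ => (eqFormula_isQF _ _).not.inf
    (((edgeFormula_isQF _ _).sup (edgeFormula_isQF _ _)).sup (eqFormula_isQF _ _))

theorem insFormula_isQF (k n : ℕ) : (insFormula k n).IsQF :=
  (extFormula_isQF _).sup (((attachFormula_isQF _ _ _).inf (extFormula_isQF _)).sup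
    (((attachFormula_isQF _ _ _).inf (extFormula_isQF _)).sup
      ((eqFormula_isQF _ _).not.inf ((attachFormula_isQF _ _ _).inf
        ((attachFormula_isQF _ _ _).inf (extFormula_isQF _))))))

variable {D : Type} (G : Digraph D) (w : α → D)

theorem realize_eqFormula (x y : α) :
    @Formula.Realize _ D (cliqueState k G).toStructure _ (eqFormula x y) w ↔ w x = w y :=
  Iff.rfl

theorem realize_edgeFormula (x y : α) :
    @Formula.Realize _ D (cliqueState k G).toStructure _ (edgeFormula x y) w ↔
      G.Adj (w x) (w y) :=
  Iff.rfl

/-- The updates of arities `k` and `k + 1` ask about lengths `k + 2` and `k + 3`, for which no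
symbol exists: the answer is constantly true at `k + 2` and false beyond. -/
theorem realize_extFormula {j : ℕ} (t : Fin j → α) :
    @Formula.Realize _ D (cliqueState k G).toStructure _ (extFormula t) w ↔
      CliqueExtension (k + 2) G j (Set.range (w ∘ t)) := by
  let _ := (cliqueState k G).toStructure
  unfold extFormula
  split_ifs with h₁ h₂
  · exact Iff.rfl
  · subst h₂
    exact iff_of_true (BoundedFormula.realize_top.2 trivial) (cliqueExtension_self _ _ _)
  · exact iff_of_false id (not_cliqueExtension_of_lt _ (by omega) _)

theorem realize_attachFormula {j : ℕ} (a b : α) (t : Fin j → α) :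
    @Formula.Realize _ D (cliqueState k G).toStructure _ (attachFormula a b t) w ↔
      Attachable G (w a) (w b) (Set.range (w ∘ t)) := by
  let _ := (cliqueState k G).toStructure
  rw [Attachable, Set.forall_mem_range]
  refine BoundedFormula.realize_iInf.trans (forall_congr' fun i => ?_)
  rw [BoundedFormula.realize_inf, BoundedFormula.realize_sup, BoundedFormula.realize_sup,
    BoundedFormula.realize_not]
  exact Iff.rfl

theorem realize_insFormula (n : ℕ) (u v : D) (x : Fin n → D) :
    @Formula.Realize _ D (cliqueState k G).toStructure _ (insFormula k n) (Sum.elim ![u, v] x) ↔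
      CliqueExtension (k + 2) (Modification.apply ⟨.ins, u, v⟩ G) n (Set.range x) := by
  let str := (cliqueState k G).toStructure
  have hrange {j : ℕ} (a : Fin 2 ⊕ Fin n) (t : Fin j → Fin 2 ⊕ Fin n) :
      Set.range (Sum.elim ![u, v] x ∘ (Fin.cons a t : Fin (j + 1) → _)) =
        insert (Sum.elim ![u, v] x a) (Set.range (Sum.elim ![u, v] x ∘ t)) := by
    rw [Set.range_comp, Fin.range_cons, Set.image_insert_eq, ← Set.range_comp]
  rw [cliqueExtension_insertion_iff]
  simp only [insFormula, Formula.realize_sup, Formula.realize_inf, Formula.realize_not]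
  simp only [realize_extFormula, realize_attachFormula, realize_eqFormula, hrange]
  exact Iff.rfl

end CliqueProgram

/-- The program maintaining the `(k + 2)`-clique query under insertions. -/
noncomputable def cliqueProgram (k : ℕ) : DynProgram where
  aux := cliqueSchema k
  relational := inferInstance
  update δ n _ :=
    match δ with
    | .ins => CliqueProgram.insFormula k n
    -- An arbitrary choice, as only insertions are considered.
    | .del => ⊥
  initAux _ _ G := cliqueDB k G
  query := ⟨Nat.zero_le _⟩

/-- The invariant of the program: the recurrence, read as update formulas, keeps the database
correct. -/
theorem cliqueProgram_step (k : ℕ) {D : Type} (G : Digraph D) (u v : D) :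
    (cliqueProgram k).step (cliqueState k G) ⟨.ins, u, v⟩ =
      cliqueState k (Modification.apply ⟨.ins, u, v⟩ G) := by
  refine congrArg (ProgState.mk _) (Structure.ext ?_ ?_)
  · funext n f
    exact f.elim
  · funext n R x
    exact propext (CliqueProgram.realize_insFormula G n u v x)

theorem cliqueProgram_steps (k : ℕ) {D : Type} (αs : List (Modification D))
    (hα : ∀ α ∈ αs, α.kind = ModKind.ins) (G : Digraph D) :
    (cliqueProgram k).steps (cliqueState k G) αs =
      cliqueState k (Modification.applySeq αs G) := by
  induction αs generalizing G with
  | nil => rfl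
  | cons α αs ih =>
    obtain ⟨κ, u, v⟩ := α
    obtain rfl : κ = .ins := hα _ List.mem_cons_self
    refine Eq.trans ?_ (ih (fun β hβ => hα β (List.mem_cons_of_mem _ hβ)) _)
    rw [← cliqueProgram_step]
    rfl

theorem cliqueProgram_maintains (k : ℕ) :
    (cliqueProgram k).MaintainsUnderInsertions (cliqueQuery (k + 2)) := by
  intro D _ G αs hα
  rw [cliqueQuery_iff_cliqueExtension]
  change (cliqueProgram k).queryBit ((cliqueProgram k).steps (cliqueState k G) αs) ↔ _
  rw [cliqueProgram_steps k αs hα, ← Set.range_eq_empty (Fin.elim0 : Fin 0 → D)]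
  exact Iff.rfl

theorem cliqueProgram_isQuantifierFree (k : ℕ) : (cliqueProgram k).IsQuantifierFree := by
  rintro (_ | _) n R
  · exact CliqueProgram.insFormula_isQF k n
  · exact BoundedFormula.isQF_bot

theorem cliqueProgram_isKAry (k : ℕ) : (cliqueProgram k).IsKAry (k + 1) :=
  fun _ ⟨R⟩ => R.down

theorem cliqueProgram_hasFiniteSchema (k : ℕ) : (cliqueProgram k).HasFiniteSchema := by
  refine Finite.of_injective
    (fun R : Σ n, PLift (n ≤ k + 1) => (⟨R.1, Nat.lt_succ_of_le R.2.down⟩ : Fin (k + 2))) ?_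
  rintro ⟨n, ⟨hn⟩⟩ ⟨m, ⟨hm⟩⟩ h
  obtain rfl : n = m := congrArg Fin.val h
  rfl

end

theorem theorem5p2 (k : ℕ) (hk : 1 ≤ k) :
    (¬ ∃ P : DynProgram, P.IsQuantifierFree ∧ P.IsKAry k ∧
        P.MaintainsUnderInsertions (cliqueQuery (k + 2))) ∧
    (∃ P : DynProgram, P.HasFiniteSchema ∧ P.IsQuantifierFree ∧ P.IsKAry (k + 1) ∧
        P.MaintainsUnderInsertions (cliqueQuery (k + 2))) :=
  ⟨fun ⟨P, hQF, hA, hM⟩ => not_maintains_cliqueQuery_of_isKAry hk P hQF hA hM,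
    cliqueProgram k, cliqueProgram_hasFiniteSchema k, cliqueProgram_isQuantifierFree k,
    cliqueProgram_isKAry k, cliqueProgram_maintains k⟩
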